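/- Let $M\in\mathbb{C}^{n\times n}$ be positive-definite in the sense that $\operatorname{Re}(x^*Mx)>0$ for every unit vector $x\in\mathbb{C}^n$ ($M$ need not be Hermitian), let $b\in\mathbb{C}^n$ and let $k\ge 1$. The Arnoldi process (with modified Gram--Schmidt) starts from $q_1=b/\|b\|$ and for $j=1,\dots,k$ sets $w=Mq_j$; then, for $i=1,\dots,j$ in turn, $h_{i,j}=q_i^*w$ and $w\leftarrow w-h_{i,j}q_i$; then $h_{j+1,j}=\|w\|$; it stops if $h_{j+1,j}=0$, and otherwise sets $q_{j+1}=w/h_{j+1,j}$. Let $m\le k$ be the number of passes that are performed, so that $m=k$ unless $h_{j+1,j}=0$ for some $j<k$. Put $Q_k=[q_1,\dots,q_m]\in\mathbb{C}^{n\times m}$ and let $H_k=(h_{i,j})_{1\le i,j\le m}$ be the resulting upper Hessenberg matrix. (If $b=0$, put $q_1=0$; the claim is then trivial.) For $f$ analytic near the spectrum of a square matrix $A$ let $f(A)$ be the usual matrix function, defined through the Jordan form of $A$: on a Jordan block with eigenvalue $\mu$ and nilpotent part $N$ it is $\sum_{j}\frac{f^{(j)}(\mu)}{j!}N^j$. Let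 $x^{1/2}$ denote the principal branch of the square root, and let $M^{1/2}$ be the corresponding function of $M$. Let $$\operatorname{Arn}_k(x^{1/2};M,b)=Q_k\,H_k^{1/2}\,Q_k^*b$$ be the $k$-th Arnoldi approximation of $M^{1/2}b$, and let $$\xi_0^k=M^{-1}b-Q_kH_k^{-1}\|b\|e_1$$ be the error of the full orthogonalization method (FOM) with zero initial guess for $Mx=b$. Let $\lambda_1(H_k),\dots,\lambda_m(H_k)$ be the eigenvalues of $H_k$, repeated according to algebraic multiplicity. Then, in the Euclidean norm, $$\bigl\|M^{1/2}b-\operatorname{Arn}_k(x^{1/2};M,b)\bigr\|\le\frac1\pi\left(\int_0^\infty x^{1/2}\prod_{i=1}^{m}\left|\frac{\lambda_i(H_k)}{\lambda_i(H_k)+x}\right|dx\right)\bigl\|\xi_0^k\bigr\| .$$ The integral of the nonnegative integrand is taken in $[0,\infty]$, with the convention $\infty\cdot 0=0$ on the right-hand side. -/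

import Mathlib

open scoped Matrix

/-! ### Functions of a matrix -/

/-- The generalized eigenspace of `T` at `μ` and the sum of all the other generalized eigenspaces
are complementary. -/
theorem isCompl_maxGenEigenspace {V : Type*} [AddCommGroup V] [Module ℂ V] [FiniteDimensional ℂ V]
    (T : Module.End ℂ V) (μ : ℂ) :
    IsCompl (T.maxGenEigenspace μ) (⨆ (ν : ℂ) (_ : ν ≠ μ), T.maxGenEigenspace ν) := by
  refine ⟨T.independent_maxGenEigenspace μ, ?_⟩
  rw [codisjoint_iff, ← top_le_iff, ← Module.End.iSup_maxGenEigenspace_eq_top T]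
  refine iSup_le fun ν => ?_
  by_cases h : ν = μ
  · subst h
    exact le_sup_left
  · exact le_sup_of_le_right (le_iSup₂_of_le ν h le_rfl)

/-- The spectral projection of `T` at `μ`: the projection onto the generalized eigenspace of `μ`
along the sum of the generalized eigenspaces of the other eigenvalues. -/
noncomputable def spectralProjection {V : Type*} [AddCommGroup V] [Module ℂ V]
    [FiniteDimensional ℂ V] (T : Module.End ℂ V) (μ : ℂ) : Module.End ℂ V :=
  Submodule.projection _ _ (isCompl_maxGenEigenspace T μ)

/-- The matrix function `f(A)`, defined through the Jordan structure of `A`: on the generalized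
eigenspace of the eigenvalue `μ`, where `N = A - μ` is nilpotent, `f(A)` acts as
`∑ j, f⁽ʲ⁾(μ) / j! • N ^ j`. On a Jordan block of size `m` of a Jordan form `A = Z J Z⁻¹` this is
the upper triangular Toeplitz matrix with entries `f(μ), f'(μ), …, f⁽ᵐ⁻¹⁾(μ) / (m - 1)!`, because
`N ^ j` vanishes there for `j ≥ m`. -/
noncomputable def matrixFunction {n : ℕ} (f : ℂ → ℂ) (A : Matrix (Fin n) (Fin n) ℂ) :
    Matrix (Fin n) (Fin n) ℂ :=
  LinearMap.toMatrix' (∑ μ ∈ A.charpoly.roots.toFinset,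
    (∑ j ∈ Finset.range n, (iteratedDeriv j f μ / (j.factorial : ℂ)) •
      (Matrix.toLin' A - algebraMap ℂ (Module.End ℂ (Fin n → ℂ)) μ) ^ j) *
      spectralProjection (Matrix.toLin' A) μ)

/-- The principal branch of the square root, analytic off the nonpositive real axis. -/
noncomputable def principalSqrt (z : ℂ) : ℂ := z ^ (1 / 2 : ℂ)

/-- A possibly non-Hermitian complex matrix is positive-definite if `Re (x* M x) > 0` for every
unit vector `x`. -/
def IsPositiveDefinite {n : ℕ} (M : Matrix (Fin n) (Fin n) ℂ) : Prop :=
  ∀ x : EuclideanSpace ℂ (Fin n), ‖x‖ = 1 → 0 < (inner ℂ x (Matrix.toEuclideanLin M x)).re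

/-! ### The Arnoldi process

All indices start at `0`: `arnoldiVector M b j` is the vector `q_{j+1}`, and `arnoldiEntry M b i j`
is the number `h_{i+1,j+1}`. -/

/-- The inner loop (modified Gram-Schmidt): starting from `w`, subtract successively the components
along `q 0, …, q (i - 1)`. -/
noncomputable def orthogonalize {n : ℕ} (q : ℕ → EuclideanSpace ℂ (Fin n))
    (w : EuclideanSpace ℂ (Fin n)) : ℕ → EuclideanSpace ℂ (Fin n)
  | 0 => w
  | i + 1 => orthogonalize q w i - inner ℂ (q i) (orthogonalize q w i) • q i

/-- The list of vectors known after `j` passes of the outer loop: its entries `0, …, j` are the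
Arnoldi vectors and its later entries are `0`. -/
noncomputable def arnoldiState {n : ℕ} (M : Matrix (Fin n) (Fin n) ℂ)
    (b : EuclideanSpace ℂ (Fin n)) : ℕ → ℕ → EuclideanSpace ℂ (Fin n)
  | 0 => Function.update (fun _ => 0) 0 (((‖b‖ : ℂ)⁻¹) • b)
  | j + 1 =>
    let q := arnoldiState M b j
    let w := orthogonalize q (Matrix.toEuclideanLin M (q j)) (j + 1)
    Function.update q (j + 1) (((‖w‖ : ℂ)⁻¹) • w)

/-- The Arnoldi vector `q_{j+1}`. -/
noncomputable def arnoldiVector {n : ℕ} (M : Matrix (Fin n) (Fin n) ℂ)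
    (b : EuclideanSpace ℂ (Fin n)) (j : ℕ) : EuclideanSpace ℂ (Fin n) :=
  arnoldiState M b j j

/-- The vector `w` in pass `j + 1` of the outer loop, after `i` steps of the inner loop. -/
noncomputable def arnoldiWork {n : ℕ} (M : Matrix (Fin n) (Fin n) ℂ)
    (b : EuclideanSpace ℂ (Fin n)) (j i : ℕ) : EuclideanSpace ℂ (Fin n) :=
  orthogonalize (arnoldiVector M b) (Matrix.toEuclideanLin M (arnoldiVector M b j)) i

/-- The Hessenberg entry `h_{i+1,j+1}`. -/
noncomputable def arnoldiEntry {n : ℕ} (M : Matrix (Fin n) (Fin n) ℂ)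
    (b : EuclideanSpace ℂ (Fin n)) (i j : ℕ) : ℂ :=
  if i ≤ j then inner ℂ (arnoldiVector M b i) (arnoldiWork M b j i)
  else if i = j + 1 then (‖arnoldiWork M b j (j + 1)‖ : ℂ)
  else 0

open scoped Classical in
/-- The number of passes that the process with iteration number `k` performs: `k` itself, unless
some earlier pass produces a zero subdiagonal entry, where the process stops. -/
noncomputable def arnoldiSteps {n : ℕ} (M : Matrix (Fin n) (Fin n) ℂ)
    (b : EuclideanSpace ℂ (Fin n)) (k : ℕ) : ℕ :=
  Nat.findGreatest (fun m => ∀ j : ℕ, j + 1 < m → arnoldiEntry M b (j + 1) j ≠ 0) k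

/-- The matrix `Q_k` whose columns are the Arnoldi vectors. -/
noncomputable def arnoldiQ {n : ℕ} (M : Matrix (Fin n) (Fin n) ℂ)
    (b : EuclideanSpace ℂ (Fin n)) (k : ℕ) : Matrix (Fin n) (Fin (arnoldiSteps M b k)) ℂ :=
  Matrix.of fun i j => arnoldiVector M b j i

/-- The upper Hessenberg matrix `H_k`. -/
noncomputable def arnoldiH {n : ℕ} (M : Matrix (Fin n) (Fin n) ℂ)
    (b : EuclideanSpace ℂ (Fin n)) (k : ℕ) :
    Matrix (Fin (arnoldiSteps M b k)) (Fin (arnoldiSteps M b k)) ℂ :=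
  Matrix.of fun i j => arnoldiEntry M b i j

/-- The Arnoldi approximation `Arn_k(f; M, b) = Q_k f(H_k) Q_k* b`. -/
noncomputable def arnoldiApprox {n : ℕ} (f : ℂ → ℂ) (M : Matrix (Fin n) (Fin n) ℂ)
    (b : EuclideanSpace ℂ (Fin n)) (k : ℕ) : EuclideanSpace ℂ (Fin n) :=
  Matrix.toEuclideanLin
    (arnoldiQ M b k * matrixFunction f (arnoldiH M b k) * (arnoldiQ M b k)ᴴ) b

/-- The error `ξ_z^k = (M - z I)⁻¹ b - Q_k (H_k - z I)⁻¹ (‖b‖ e₁)` of the full orthogonalization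
method with zero initial guess for the system `(M - z I) x = b`. -/
noncomputable def fomError {n : ℕ} (M : Matrix (Fin n) (Fin n) ℂ)
    (b : EuclideanSpace ℂ (Fin n)) (k : ℕ) (z : ℂ) : EuclideanSpace ℂ (Fin n) :=
  Matrix.toEuclideanLin (M - z • 1)⁻¹ b -
    Matrix.toEuclideanLin (arnoldiQ M b k * (arnoldiH M b k - z • 1)⁻¹)
      (WithLp.toLp 2 fun i => if (i : ℕ) = 0 then (‖b‖ : ℂ) else 0)

/-! For `Re z > 0`, `π z^{1/2} = ∫₀^∞ (x^{-1/2} - x^{1/2} (z + x)⁻¹) dx`. Differentiating under the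
integral gives all Taylor coefficients of the root, so the formula passes to matrices with spectrum
in the right half-plane (`integral_sqrtIntegrand`). This covers `M`, and also `H_k`, since `Q_k` is
an isometry and so `H_k` inherits positivity. As `Q_k ‖b‖e₁ = b`, the `x^{-1/2}` terms cancel in the
difference, and `π` times the error is `-∫ x^{1/2} ξ_{-x} dx`, with `ξ_{-x}` the FOM error for `M +
x` (`pi_smul_sqrt_error`).

The Arnoldi relation `M Q = Q H + w e_mᵀ` makes `(M + x) ξ_{-x}` a multiple of `w`. The factor
involves the last-first entry of `(H + x)⁻¹`, which is a cofactor over `det (H + x)`; for a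
Hessenberg matrix that cofactor does not depend on `x`. Comparing with `x = 0` gives `ξ_{-x} = (det
H / det (H + x)) M (M + x)⁻¹ ξ_0`. The ratio is `∏ λᵢ / (λᵢ + x)`, and positivity of `M` gives `‖M
(M + x)⁻¹‖ ≤ 1` (`norm_fomError_le`). Taking norms under the integral concludes. -/

open MeasureTheory Filter Topology

/-! ### The integral representation of the square root and of its derivatives -/

/-- For `j = 0` the integrand of `π z^{1/2} = ∫ x^{-1/2} z / (z + x) dx`, and in general its
`j`-th derivative with respect to `z`, divided by `j!`. -/
noncomputable def sqrtKernel (j : ℕ) (z : ℂ) (x : ℝ) : ℂ :=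
  (if j = 0 then ((√x : ℝ) : ℂ)⁻¹ else 0) - ((√x : ℝ) : ℂ) * ((-1) ^ j / (z + x) ^ (j + 1))

theorem add_ofReal_ne_zero {z : ℂ} (hz : 0 < z.re) {x : ℝ} (hx : 0 ≤ x) : z + x ≠ 0 := by
  intro h
  have := congrArg Complex.re h
  simp at this
  linarith

theorem le_norm_add_ofReal {z : ℂ} {c : ℝ} (hz : c ≤ z.re) (x : ℝ) : c + x ≤ ‖z + x‖ :=
  le_trans (by simpa using hz) (Complex.re_le_norm (z + x))

/-- The common majorant of all the kernels on `Re z ≥ c`. Its antiderivative `(2/√c) arctan (√x/√c)`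
is bounded. -/
theorem integrableOn_inv_sqrt_mul_inv {c : ℝ} (hc : 0 < c) :
    IntegrableOn (fun x : ℝ => (√x)⁻¹ * (c + x)⁻¹) (Set.Ioi 0) := by
  have hs : 0 < √c := Real.sqrt_pos.2 hc
  have hlim : Tendsto (fun x : ℝ => 2 / √c * Real.arctan (√x / √c)) atTop
      (𝓝 (2 / √c * (Real.pi / 2))) := by
    refine Tendsto.const_mul _ ((tendsto_nhds_of_tendsto_nhdsWithin
      Real.tendsto_arctan_atTop).comp ?_)
    exact Real.tendsto_sqrt_atTop.atTop_div_const hs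
  refine integrableOn_Ioi_deriv_of_nonneg (Continuous.continuousWithinAt (by fun_prop))
    (fun x hx => ?_) (fun x hx => ?_) hlim
  · have hx : (0 : ℝ) < x := hx
    have hsx : 0 < √x := Real.sqrt_pos.2 hx
    have h := ((((Real.hasDerivAt_sqrt hx.ne').div_const (√c)).arctan).const_mul (2 / √c))
    refine h.congr_deriv ?_
    rw [div_pow, Real.sq_sqrt hx.le, Real.sq_sqrt hc.le]
    field_simp
    rw [Real.sq_sqrt hc.le]
  · have hx : (0 : ℝ) < x := hx
    positivity

theorem sqrtKernel_zero {z : ℂ} {x : ℝ} (hz : 0 < z.re) (hx : 0 < x) :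
    sqrtKernel 0 z x = ((√x : ℝ) : ℂ)⁻¹ * (z / (z + x)) := by
  have h1 := add_ofReal_ne_zero hz hx.le
  have h2 : ((√x : ℝ) : ℂ) ≠ 0 := by exact_mod_cast (Real.sqrt_pos.2 hx).ne'
  have h3 : ((√x : ℝ) : ℂ) ^ 2 = x := by exact_mod_cast Real.sq_sqrt hx.le
  simp only [sqrtKernel, if_true, pow_zero, zero_add, pow_one]
  field_simp
  rw [h3]
  ring

theorem norm_sqrtKernel_zero_le {z : ℂ} {c : ℝ} (hc : 0 < c) (hz : c ≤ z.re) {x : ℝ} (hx : 0 < x) :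
    ‖sqrtKernel 0 z x‖ ≤ ‖z‖ * ((√x)⁻¹ * (c + x)⁻¹) := by
  rw [sqrtKernel_zero (hc.trans_le hz) hx, norm_mul, norm_inv, norm_div, Complex.norm_real,
    Real.norm_of_nonneg (Real.sqrt_nonneg x), div_eq_mul_inv, mul_left_comm]
  have := le_norm_add_ofReal hz x
  gcongr

/-- Of the `j + 2` factors `1/(c + x)`, one absorbs `x = √x·√x`, one is kept, and the other `j` are
at most `1/c`. -/
theorem norm_sqrtKernel_succ_le {z : ℂ} {c : ℝ} (hc : 0 < c) (hz : c ≤ z.re) (j : ℕ)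
    {x : ℝ} (hx : 0 < x) :
    ‖sqrtKernel (j + 1) z x‖ ≤ (c⁻¹) ^ j * ((√x)⁻¹ * (c + x)⁻¹) := by
  have h1 := le_norm_add_ofReal hz x
  have hsx : 0 < √x := Real.sqrt_pos.2 hx
  have h3 : √x = (√x)⁻¹ * x := by
    rw [eq_inv_mul_iff_mul_eq₀ hsx.ne']; exact Real.mul_self_sqrt hx.le
  have h2 : ‖sqrtKernel (j + 1) z x‖ = √x * (‖z + x‖⁻¹) ^ (j + 2) := by
    simp [sqrtKernel, abs_of_nonneg hsx.le]
  rw [h2]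
  calc √x * (‖z + x‖⁻¹) ^ (j + 2) ≤ √x * ((c + x)⁻¹) ^ (j + 2) := by gcongr
    _ = (√x)⁻¹ * (x * (c + x)⁻¹) * ((c + x)⁻¹ * ((c + x)⁻¹) ^ j) := by
        nth_rw 1 [h3]; ring
    _ ≤ (√x)⁻¹ * 1 * ((c + x)⁻¹ * (c⁻¹) ^ j) := by
        gcongr
        · rw [← div_eq_mul_inv, div_le_one (by positivity)]; linarith
        · linarith
    _ = _ := by ring

theorem continuousOn_sqrtKernel (j : ℕ) {z : ℂ} (hz : 0 < z.re) :
    ContinuousOn (sqrtKernel j z) (Set.Ioi 0) := by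
  unfold sqrtKernel
  have h : ∀ x ∈ Set.Ioi (0 : ℝ), (z + x) ^ (j + 1) ≠ 0 := fun x hx =>
    pow_ne_zero _ (add_ofReal_ne_zero hz (le_of_lt hx))
  have h2 : ∀ x ∈ Set.Ioi (0 : ℝ), ((√x : ℝ) : ℂ) ≠ 0 := fun x hx => by
    exact_mod_cast (Real.sqrt_pos.2 hx).ne'
  split_ifs
  · exact ContinuousOn.sub (ContinuousOn.inv₀ (by fun_prop) h2)
      (ContinuousOn.mul (by fun_prop) (ContinuousOn.div (by fun_prop) (by fun_prop) h))
  · exact ContinuousOn.sub (by fun_prop)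
      (ContinuousOn.mul (by fun_prop) (ContinuousOn.div (by fun_prop) (by fun_prop) h))

theorem aestronglyMeasurable_sqrtKernel (j : ℕ) {z : ℂ} (hz : 0 < z.re) :
    AEStronglyMeasurable (sqrtKernel j z) (volume.restrict (Set.Ioi 0)) :=
  (continuousOn_sqrtKernel j hz).aestronglyMeasurable measurableSet_Ioi

theorem integrableOn_sqrtKernel (j : ℕ) {z : ℂ} (hz : 0 < z.re) :
    IntegrableOn (sqrtKernel j z) (Set.Ioi 0) := by
  have hm := aestronglyMeasurable_sqrtKernel j hz
  cases j with
  | zero =>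
    refine Integrable.mono' ((integrableOn_inv_sqrt_mul_inv hz).const_mul ‖z‖) hm ?_
    exact (ae_restrict_iff' measurableSet_Ioi).2 (.of_forall fun x hx =>
      norm_sqrtKernel_zero_le hz le_rfl hx)
  | succ j =>
    refine Integrable.mono' ((integrableOn_inv_sqrt_mul_inv hz).const_mul ((z.re⁻¹) ^ j)) hm ?_
    exact (ae_restrict_iff' measurableSet_Ioi).2 (.of_forall fun x hx =>
      norm_sqrtKernel_succ_le hz le_rfl j hx)

theorem hasDerivAt_sqrtKernel (j : ℕ) {z : ℂ} (hz : 0 < z.re) {x : ℝ} (hx : 0 < x) :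
    HasDerivAt (fun w => sqrtKernel j w x) ((j + 1) * sqrtKernel (j + 1) z x) z := by
  have h1 := add_ofReal_ne_zero hz hx.le
  have h := (((((hasDerivAt_id z).add_const (x : ℂ)).pow (j + 1)).inv (pow_ne_zero _ h1)).const_mul
    ((√x : ℂ) * (-1) ^ j)).const_sub (if j = 0 then ((√x : ℝ) : ℂ)⁻¹ else 0)
  refine (h.congr_of_eventuallyEq (.of_forall fun w => ?_)).congr_deriv ?_
  · simp [sqrtKernel, div_eq_mul_inv, mul_assoc]
  · simp only [sqrtKernel, Nat.add_eq_zero_iff, one_ne_zero, and_false, if_false, id,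
      Nat.add_sub_cancel, Pi.pow_apply]
    push_cast
    field_simp
    ring

theorem hasDerivAt_integral_sqrtKernel (j : ℕ) {z : ℂ} (hz : 0 < z.re) :
    HasDerivAt (fun w => ∫ x in Set.Ioi (0 : ℝ), sqrtKernel j w x)
      (∫ x in Set.Ioi (0 : ℝ), (j + 1) * sqrtKernel (j + 1) z x) z := by
  -- Half of `z.re` leaves a neighbourhood of `z` on which one majorant serves all `w`.
  have hc : 0 < z.re / 2 := by positivity
  have hnhds : {w : ℂ | z.re / 2 < w.re} ∈ 𝓝 z :=
    (isOpen_lt continuous_const Complex.continuous_re).mem_nhds (by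
      show z.re / 2 < z.re
      linarith)
  refine (hasDerivAt_integral_of_dominated_loc_of_deriv_le
    (bound := fun x => (j + 1) * (((z.re / 2)⁻¹) ^ j * ((√x)⁻¹ * (z.re / 2 + x)⁻¹)))
    (F' := fun w x => (j + 1) * sqrtKernel (j + 1) w x) hnhds ?_
    (integrableOn_sqrtKernel j hz) ?_ ?_ ?_ ?_).2
  · filter_upwards [hnhds] with w hw
    exact aestronglyMeasurable_sqrtKernel j (hc.trans hw)
  · exact (aestronglyMeasurable_sqrtKernel (j + 1) hz).const_mul _
  · refine (ae_restrict_iff' measurableSet_Ioi).2 (.of_forall fun x hx w hw => ?_)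
    rw [norm_mul]
    have : ‖(j + 1 : ℂ)‖ = j + 1 := by exact_mod_cast Complex.norm_natCast (j + 1)
    rw [this]
    gcongr
    exact norm_sqrtKernel_succ_le hc (le_of_lt hw) j hx
  · exact ((integrableOn_inv_sqrt_mul_inv hc).const_mul _).const_mul _
  · exact (ae_restrict_iff' measurableSet_Ioi).2 (.of_forall fun x hx w hw =>
      hasDerivAt_sqrtKernel j (hc.trans hw) hx)

theorem principalSqrt_sq (z : ℂ) : principalSqrt z ^ 2 = z := by
  simp [principalSqrt]

theorem principalSqrt_re_pos {z : ℂ} (hz : 0 < z.re) : 0 < (principalSqrt z).re := by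
  have h0 : z ≠ 0 := by rintro rfl; simp at hz
  have harg := abs_lt.1 (Complex.abs_arg_lt_pi_div_two_iff.2 (Or.inl hz))
  rw [principalSqrt, Complex.cpow_def_of_ne_zero h0, Complex.exp_re]
  refine mul_pos (Real.exp_pos _) (Real.cos_pos_of_mem_Ioo ?_)
  have : (Complex.log z * (1 / 2)).im = z.arg / 2 := by
    rw [show (1 / 2 : ℂ) = ((1 / 2 : ℝ) : ℂ) by norm_num, Complex.im_mul_ofReal, Complex.log_im]
    ring
  rw [this]
  constructor <;> linarith [Real.pi_pos]

theorem integral_sqrtKernel_zero {z : ℂ} (hz : 0 < z.re) :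
    ∫ x in Set.Ioi (0 : ℝ), sqrtKernel 0 z x = Real.pi * principalSqrt z := by
  set s := principalSqrt z with hs
  have hs2 : s ^ 2 = z := principalSqrt_sq z
  have hsre : 0 < s.re := principalSqrt_re_pos hz
  have hp : ∀ t : ℝ, s + t * Complex.I ∈ Complex.slitPlane := fun t => Or.inl (by simpa using hsre)
  have hm : ∀ t : ℝ, s - t * Complex.I ∈ Complex.slitPlane := fun t => Or.inl (by simpa using hsre)
  -- This is `2 s arctan (t/s)` in logarithms, the antiderivative after substituting `x = t²`. Since
  -- `Re s > 0`, both arguments avoid the branch cut.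
  let G : ℝ → ℂ := fun t => -Complex.I * s *
    (Complex.log (s + t * Complex.I) - Complex.log (s - t * Complex.I))
  have hG : ∀ t : ℝ, HasDerivAt G (2 * z / (z + (t : ℂ) ^ 2)) t := by
    intro t
    have hd : HasDerivAt (fun t : ℝ => (t : ℂ) * Complex.I) Complex.I t := by
      simpa using (Complex.ofRealCLM.hasDerivAt (x := t)).mul_const Complex.I
    have h := (((hd.const_add s).clog_real (hp t)).sub
      ((hd.const_sub s).clog_real (hm t))).const_mul (-Complex.I * s)
    refine h.congr_deriv ?_
    have h1 := Complex.slitPlane_ne_zero (hp t)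
    have h2 := Complex.slitPlane_ne_zero (hm t)
    have h3 : z + (t : ℂ) ^ 2 = (s + t * Complex.I) * (s - t * Complex.I) := by
      rw [← hs2]; linear_combination (t : ℂ) ^ 2 * Complex.I_sq
    rw [h3]
    rw [div_sub_div _ _ h1 h2, ← mul_div_assoc]
    congr 1
    rw [← hs2]
    linear_combination (-2 * s ^ 2) * Complex.I_sq
  have hGlim : Tendsto G atTop (𝓝 (Real.pi * s)) := by
    have hdiv : Tendsto (fun t : ℝ => s / t) atTop (𝓝 0) := by
      have : Tendsto (fun t : ℝ => ((t⁻¹ : ℝ) : ℂ)) atTop (𝓝 ((0 : ℝ) : ℂ)) :=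
        (Complex.continuous_ofReal.tendsto 0).comp tendsto_inv_atTop_zero
      simpa [div_eq_mul_inv] using this.const_mul s
    have h1 : Tendsto (fun t : ℝ => Complex.log (s / t + Complex.I)) atTop
        (𝓝 (Complex.log Complex.I)) := by
      refine (continuousAt_clog (x := Complex.I) (by simp [Complex.slitPlane])).tendsto.comp ?_
      simpa using hdiv.add_const Complex.I
    have h2 : Tendsto (fun t : ℝ => Complex.log (s / t - Complex.I)) atTop
        (𝓝 (Complex.log (-Complex.I))) := by
      refine (continuousAt_clog (x := -Complex.I) (by simp [Complex.slitPlane])).tendsto.comp ?_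
      simpa using hdiv.sub_const Complex.I
    have h3 := (h1.sub h2).const_mul (-Complex.I * s)
    rw [Complex.log_I, Complex.log_neg_I] at h3
    have h4 : -Complex.I * s * (↑Real.pi / 2 * Complex.I - -(↑Real.pi / 2) * Complex.I)
        = Real.pi * s := by linear_combination (-s * Real.pi) * Complex.I_sq
    rw [h4] at h3
    -- Factoring `t > 0` out of both arguments adds the same `log t` to each logarithm, so the
    -- difference is unchanged.
    refine h3.congr' ?_
    filter_upwards [eventually_gt_atTop 0] with t ht
    have ht' : (t : ℂ) ≠ 0 := by exact_mod_cast ht.ne'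
    have e1 : s + t * Complex.I = t * (s / t + Complex.I) := by field_simp
    have e2 : s - t * Complex.I = t * (s / t - Complex.I) := by field_simp
    have n1 := Complex.slitPlane_ne_zero (hp t)
    have n2 := Complex.slitPlane_ne_zero (hm t)
    simp only [G]
    rw [e1] at n1 ⊢
    rw [e2] at n2 ⊢
    rw [Complex.log_ofReal_mul ht (right_ne_zero_of_mul n1),
      Complex.log_ofReal_mul ht (right_ne_zero_of_mul n2)]
    ring
  have hGc : Continuous G := continuous_iff_continuousAt.2 fun t => (hG t).continuousAt
  have := integral_Ioi_of_hasDerivAt_of_tendsto (f := fun x => G (√x)) (f' := sqrtKernel 0 z)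
    (a := 0) (m := Real.pi * s) (hGc.comp Real.continuous_sqrt).continuousWithinAt
    (fun x hx => ?_) (integrableOn_sqrtKernel 0 hz) (hGlim.comp Real.tendsto_sqrt_atTop)
  · rw [this]; simp [G]
  · have hx : (0 : ℝ) < x := hx
    have h := (hG (√x)).scomp x (Real.hasDerivAt_sqrt hx.ne')
    refine h.congr_deriv ?_
    symm
    rw [sqrtKernel_zero hz hx, Complex.real_smul]
    have : ((√x : ℝ) : ℂ) ^ 2 = x := by exact_mod_cast Real.sq_sqrt hx.le
    rw [this]
    push_cast
    have h2 : ((√x : ℝ) : ℂ) ≠ 0 := by exact_mod_cast (Real.sqrt_pos.2 hx).ne'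
    have := add_ofReal_ne_zero hz hx.le
    field_simp

theorem integral_sqrtKernel (j : ℕ) {z : ℂ} (hz : 0 < z.re) :
    ∫ x in Set.Ioi (0 : ℝ), sqrtKernel j z x =
      Real.pi * (iteratedDeriv j principalSqrt z / (j.factorial : ℂ)) := by
  induction j generalizing z with
  | zero => simpa using integral_sqrtKernel_zero hz
  | succ j ih =>
    have h1 := (hasDerivAt_integral_sqrtKernel j hz).deriv
    have h2 : (fun w => ∫ x in Set.Ioi (0 : ℝ), sqrtKernel j w x) =ᶠ[𝓝 z]
        fun w => (Real.pi / (j.factorial : ℂ)) * iteratedDeriv j principalSqrt w := by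
      filter_upwards [(isOpen_lt continuous_const Complex.continuous_re).mem_nhds hz] with w hw
      rw [ih hw]
      ring
    rw [h2.deriv_eq, deriv_const_mul_field, ← iteratedDeriv_succ, integral_const_mul] at h1
    have h3 : (j + 1 : ℂ) ≠ 0 := by exact_mod_cast j.succ_ne_zero
    have h4 : (j.factorial : ℂ) ≠ 0 := by exact_mod_cast j.factorial_ne_zero
    rw [Nat.factorial_succ]
    push_cast
    field_simp at h1 ⊢
    rw [h1]

/-! ### Spectral decomposition and the resolvent -/

section Spectral

variable {V : Type*} [AddCommGroup V] [Module ℂ V] [FiniteDimensional ℂ V] (T : Module.End ℂ V)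

theorem spectralProjection_apply_mem (μ : ℂ) (v : V) :
    spectralProjection T μ v ∈ T.maxGenEigenspace μ :=
  Submodule.projection_apply_mem _ v

theorem spectralProjection_apply_of_mem {μ : ℂ} {v : V} (hv : v ∈ T.maxGenEigenspace μ) :
    spectralProjection T μ v = v :=
  Submodule.projection_apply_of_mem_left _ hv

theorem spectralProjection_apply_of_mem_ne {μ ν : ℂ} (h : ν ≠ μ) {v : V}
    (hv : v ∈ T.maxGenEigenspace ν) : spectralProjection T μ v = 0 :=
  (Submodule.projection_apply_eq_zero_iff _).2
    (Submodule.mem_iSup_of_mem ν (Submodule.mem_iSup_of_mem h hv))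

/-- The generalized eigenspaces span, so it suffices to test vectors of one of them; those of
non-eigenvalues are zero. -/
theorem sum_spectralProjection_apply (s : Finset ℂ) (hs : ∀ μ, T.HasEigenvalue μ → μ ∈ s) (v : V) :
    ∑ μ ∈ s, spectralProjection T μ v = v := by
  have hv : v ∈ ⨆ μ, T.maxGenEigenspace μ := by
    rw [Module.End.iSup_maxGenEigenspace_eq_top]; trivial
  induction hv using Submodule.iSup_induction' with
  | mem ν v hv =>
    by_cases h0 : v = 0
    · simp [h0]
    have hν : T.HasEigenvalue ν := by
      by_contra h
      have hb : T.maxGenEigenspace ν = ⊥ := by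
        by_contra hne
        apply h
        rw [Module.End.maxGenEigenspace_eq_genEigenspace_finrank] at hne
        exact Module.End.hasEigenvalue_of_hasGenEigenvalue (k := Module.finrank ℂ V) hne
      rw [hb] at hv
      exact h0 (by simpa using hv)
    rw [Finset.sum_eq_single_of_mem ν (hs ν hν)
      (fun μ _ h => spectralProjection_apply_of_mem_ne T h.symm hv)]
    exact spectralProjection_apply_of_mem T hv
  | zero => simp
  | add x y _ _ hx hy => simp only [map_add, Finset.sum_add_distrib, hx, hy]

end Spectral

/-- With `N = T - μ`, `T + t = (μ + t) + N`, whose Neumann series telescopes and stops because `N ^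
n` kills `u`. -/
theorem add_smul_sum_geometric {V : Type*} [AddCommGroup V] [Module ℂ V] (T : Module.End ℂ V)
    {μ t : ℂ} (ht : μ + t ≠ 0) (n : ℕ) (u : V)
    (hu : ((T - algebraMap ℂ (Module.End ℂ V) μ) ^ n) u = 0) :
    (T + algebraMap ℂ (Module.End ℂ V) t) (∑ j ∈ Finset.range n,
      ((-1) ^ j / (μ + t) ^ (j + 1)) • ((T - algebraMap ℂ (Module.End ℂ V) μ) ^ j) u) = u := by
  set N := T - algebraMap ℂ (Module.End ℂ V) μ with hN
  have hT : T + algebraMap ℂ (Module.End ℂ V) t = N + algebraMap ℂ (Module.End ℂ V) (μ + t) := by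
    rw [hN, map_add]; abel
  have key : ∀ m : ℕ, (T + algebraMap ℂ (Module.End ℂ V) t) (∑ j ∈ Finset.range m,
      ((-1) ^ j / (μ + t) ^ (j + 1)) • (N ^ j) u) = u - ((-1) ^ m / (μ + t) ^ m) • (N ^ m) u := by
    intro m
    induction m with
    | zero => simp
    | succ m ih =>
      rw [Finset.sum_range_succ, map_add, ih, hT]
      simp only [LinearMap.add_apply, map_smul, Module.algebraMap_end_apply]
      rw [← Module.End.mul_apply, ← pow_succ', smul_add, smul_smul]
      have e1 : (-1) ^ m / (μ + t) ^ (m + 1) * (μ + t) = (-1) ^ m / (μ + t) ^ m := by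
        rw [pow_succ]
        field_simp
      have e2 : (-1 : ℂ) ^ (m + 1) / (μ + t) ^ (m + 1) = - ((-1) ^ m / (μ + t) ^ (m + 1)) := by
        ring
      rw [e1, e2, neg_smul]
      abel
  rw [key, hu]
  simp

/-! ### Matrix functions and resolvents through spectral projections -/

section MatrixFunction

variable {n : ℕ} (A : Matrix (Fin n) (Fin n) ℂ)

theorem mem_roots_charpoly_iff {μ : ℂ} :
    μ ∈ A.charpoly.roots.toFinset ↔
      Module.End.HasEigenvalue (Matrix.toLin' A) μ := by
  rw [Multiset.mem_toFinset, Polynomial.mem_roots A.charpoly_monic.ne_zero,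
    Module.End.hasEigenvalue_iff_isRoot_charpoly, Matrix.charpoly_toLin']

theorem pow_sub_apply_spectralProjection (μ : ℂ) (v : Fin n → ℂ) :
    ((Matrix.toLin' A - algebraMap ℂ (Module.End ℂ (Fin n → ℂ)) μ) ^ n)
      (spectralProjection (Matrix.toLin' A) μ v) = 0 := by
  have h := spectralProjection_apply_mem (Matrix.toLin' A) μ v
  rw [Module.End.maxGenEigenspace_eq_genEigenspace_finrank, Module.End.mem_genEigenspace_nat] at h
  simpa [Algebra.algebraMap_eq_smul_one] using h

theorem matrixFunction_mulVec (f : ℂ → ℂ) (v : Fin n → ℂ) :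
    matrixFunction f A *ᵥ v = ∑ μ ∈ A.charpoly.roots.toFinset, ∑ j ∈ Finset.range n,
      (iteratedDeriv j f μ / (j.factorial : ℂ)) •
        ((Matrix.toLin' A - algebraMap ℂ (Module.End ℂ (Fin n → ℂ)) μ) ^ j)
          (spectralProjection (Matrix.toLin' A) μ v) := by
  rw [matrixFunction, LinearMap.toMatrix'_mulVec]
  simp [LinearMap.sum_apply]

theorem det_sub_smul_one_eq (t : ℂ) :
    (A - (-t) • (1 : Matrix (Fin n) (Fin n) ℂ)).det = (A.charpoly.roots.map fun μ => μ + t).prod := by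
  have h := A.eval_charpoly (-t)
  have hs : (Matrix.scalar (Fin n) (-t) - A) = -(A - (-t) • (1 : Matrix (Fin n) (Fin n) ℂ)) := by
    rw [Matrix.scalar_apply, ← Matrix.smul_one_eq_diagonal]; abel
  rw [hs, Matrix.det_neg] at h
  have hsp := (IsAlgClosed.splits A.charpoly)
  have hcard : A.charpoly.roots.card = n := by
    rw [← hsp.natDegree_eq_card_roots, A.charpoly_natDegree_eq_dim, Fintype.card_fin]
  have h2 := hsp.eval_eq_prod_roots_of_monic A.charpoly_monic (-t)
  rw [h2] at h
  have h3 : (A.charpoly.roots.map fun a => -t - a) =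
      (A.charpoly.roots.map fun μ => μ + t).map (fun a => -a) := by
    rw [Multiset.map_map]
    exact Multiset.map_congr rfl fun a _ => by simp; ring
  rw [h3, Multiset.prod_map_neg, Multiset.card_map, hcard, Fintype.card_fin] at h
  exact (mul_left_cancel₀ (pow_ne_zero n (by norm_num)) h).symm

theorem isUnit_det_sub_smul_one {t : ℂ} (ht : ∀ μ ∈ A.charpoly.roots, μ + t ≠ 0) :
    IsUnit (A - (-t) • (1 : Matrix (Fin n) (Fin n) ℂ)).det := by
  rw [det_sub_smul_one_eq, isUnit_iff_ne_zero]
  intro h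
  obtain ⟨μ, hμ, h0⟩ := Multiset.mem_map.1 (Multiset.prod_eq_zero_iff.1 h)
  exact ht μ hμ h0

/-- The coefficients are the Taylor coefficients of `z ↦ (z + t)⁻¹` at `μ`, so the resolvent has the
same shape as `matrixFunction` and the two can be compared termwise. -/
theorem inv_sub_smul_one_mulVec {t : ℂ} (ht : ∀ μ ∈ A.charpoly.roots, μ + t ≠ 0) (v : Fin n → ℂ) :
    (A - (-t) • (1 : Matrix (Fin n) (Fin n) ℂ))⁻¹ *ᵥ v =
      ∑ μ ∈ A.charpoly.roots.toFinset, ∑ j ∈ Finset.range n,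
        ((-1) ^ j / (μ + t) ^ (j + 1)) •
          ((Matrix.toLin' A - algebraMap ℂ (Module.End ℂ (Fin n → ℂ)) μ) ^ j)
            (spectralProjection (Matrix.toLin' A) μ v) := by
  have hu := isUnit_det_sub_smul_one A ht
  set y := ∑ μ ∈ A.charpoly.roots.toFinset, ∑ j ∈ Finset.range n,
        ((-1) ^ j / (μ + t) ^ (j + 1)) •
          ((Matrix.toLin' A - algebraMap ℂ (Module.End ℂ (Fin n → ℂ)) μ) ^ j)
            (spectralProjection (Matrix.toLin' A) μ v) with hy
  have h1 : (A - (-t) • (1 : Matrix (Fin n) (Fin n) ℂ)) *ᵥ y = v := by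
    have e : ∀ w, (A - (-t) • (1 : Matrix (Fin n) (Fin n) ℂ)) *ᵥ w =
        (Matrix.toLin' A + algebraMap ℂ (Module.End ℂ (Fin n → ℂ)) t) w := by
      intro w
      simp [Matrix.add_mulVec, Matrix.smul_mulVec]
    rw [e, hy, map_sum]
    rw [Finset.sum_congr rfl fun μ hμ => add_smul_sum_geometric (Matrix.toLin' A)
      (ht μ (Multiset.mem_toFinset.1 hμ)) n _ (pow_sub_apply_spectralProjection A μ v)]
    exact sum_spectralProjection_apply _ _ (fun μ hμ => (mem_roots_charpoly_iff A).2 hμ) v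
  conv_lhs => rw [← h1]
  rw [Matrix.mulVec_mulVec, Matrix.nonsing_inv_mul _ hu, Matrix.one_mulVec]

/-- The integrand of `π A^{1/2} v = ∫ (x^{-1/2} - x^{1/2} (A + x)⁻¹) v dx`. -/
noncomputable def sqrtIntegrand (v : EuclideanSpace ℂ (Fin n)) (x : ℝ) :
    EuclideanSpace ℂ (Fin n) :=
  ((√x : ℝ) : ℂ)⁻¹ • v - ((√x : ℝ) : ℂ) •
    Matrix.toEuclideanLin (A - (-(x : ℂ)) • (1 : Matrix (Fin n) (Fin n) ℂ))⁻¹ v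

theorem sqrtIntegrand_eq_sum (hA : ∀ μ ∈ A.charpoly.roots, 0 < μ.re)
    (v : EuclideanSpace ℂ (Fin n)) {x : ℝ} (hx : 0 < x) :
    sqrtIntegrand A v x = ∑ μ ∈ A.charpoly.roots.toFinset, ∑ j ∈ Finset.range n,
      sqrtKernel j μ x • WithLp.toLp 2
        (((Matrix.toLin' A - algebraMap ℂ (Module.End ℂ (Fin n → ℂ)) μ) ^ j)
          (spectralProjection (Matrix.toLin' A) μ v.ofLp)) := by
  have hv : v.ofLp = ∑ μ ∈ A.charpoly.roots.toFinset, ∑ j ∈ Finset.range n,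
      (if j = 0 then (1 : ℂ) else 0) •
        (((Matrix.toLin' A - algebraMap ℂ (Module.End ℂ (Fin n → ℂ)) μ) ^ j)
          (spectralProjection (Matrix.toLin' A) μ v.ofLp)) := by
    conv_lhs => rw [← sum_spectralProjection_apply (Matrix.toLin' A) A.charpoly.roots.toFinset
      (fun μ hμ => (mem_roots_charpoly_iff A).2 hμ) v.ofLp]
    refine Finset.sum_congr rfl fun μ _ => ?_
    -- For `n = 0` the range has no term `j = 0`, but the space is trivial.
    have hn : 0 < n ∨ n = 0 := by omega
    rcases hn with hn | rfl
    · rw [Finset.sum_eq_single_of_mem 0 (Finset.mem_range.2 hn)]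
      · simp
      · intro j _ hj
        simp [hj]
    · exact Subsingleton.elim _ _
  apply (WithLp.ofLp_injective 2)
  rw [sqrtIntegrand, WithLp.ofLp_sub, WithLp.ofLp_smul, WithLp.ofLp_smul, Matrix.ofLp_toLpLin,
    Matrix.toLin'_apply, inv_sub_smul_one_mulVec A
      (fun μ hμ => add_ofReal_ne_zero (hA μ hμ) hx.le)]
  conv_lhs => enter [1]; rw [hv]
  simp only [WithLp.ofLp_sum, WithLp.ofLp_smul, Finset.smul_sum, ← Finset.sum_sub_distrib,
    smul_smul, ← sub_smul]
  refine Finset.sum_congr rfl fun μ _ => Finset.sum_congr rfl fun j _ => ?_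
  congr 1
  simp [sqrtKernel]

theorem integrableOn_sqrtIntegrand (hA : ∀ μ ∈ A.charpoly.roots, 0 < μ.re)
    (v : EuclideanSpace ℂ (Fin n)) : IntegrableOn (sqrtIntegrand A v) (Set.Ioi 0) := by
  refine IntegrableOn.congr_fun ?_ (fun x hx => (sqrtIntegrand_eq_sum A hA v hx).symm)
    measurableSet_Ioi
  refine integrable_finsetSum _ fun μ hμ => integrable_finsetSum _ fun j _ => ?_
  exact (integrableOn_sqrtKernel j (hA μ (Multiset.mem_toFinset.1 hμ))).smul_const _

theorem integral_sqrtIntegrand (hA : ∀ μ ∈ A.charpoly.roots, 0 < μ.re)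
    (v : EuclideanSpace ℂ (Fin n)) :
    ∫ x in Set.Ioi (0 : ℝ), sqrtIntegrand A v x =
      (Real.pi : ℂ) • Matrix.toEuclideanLin (matrixFunction principalSqrt A) v := by
  rw [setIntegral_congr_fun measurableSet_Ioi (fun x hx => sqrtIntegrand_eq_sum A hA v hx)]
  have hint : ∀ μ ∈ A.charpoly.roots.toFinset, ∀ j : ℕ, ∀ w : EuclideanSpace ℂ (Fin n),
      IntegrableOn (fun x => sqrtKernel j μ x • w) (Set.Ioi 0) := fun μ hμ j w =>
    (integrableOn_sqrtKernel j (hA μ (Multiset.mem_toFinset.1 hμ))).smul_const _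
  rw [integral_finsetSum _ fun μ hμ => integrable_finsetSum _ fun j _ => hint μ hμ j _]
  apply (WithLp.ofLp_injective 2)
  rw [WithLp.ofLp_smul, Matrix.ofLp_toLpLin, Matrix.toLin'_apply, matrixFunction_mulVec,
    WithLp.ofLp_sum, Finset.smul_sum]
  refine Finset.sum_congr rfl fun μ hμ => ?_
  rw [integral_finsetSum _ fun j _ => hint μ hμ j _, WithLp.ofLp_sum, Finset.smul_sum]
  refine Finset.sum_congr rfl fun j _ => ?_
  rw [integral_smul_const, integral_sqrtKernel j (hA μ (Multiset.mem_toFinset.1 hμ)),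
    WithLp.ofLp_smul, smul_smul]

end MatrixFunction

/-! ### Positive-definite matrices -/

namespace IsPositiveDefinite

variable {n : ℕ} {M : Matrix (Fin n) (Fin n) ℂ}

theorem re_inner_pos (hM : IsPositiveDefinite M) {v : EuclideanSpace ℂ (Fin n)} (hv : v ≠ 0) :
    0 < (inner ℂ v (Matrix.toEuclideanLin M v)).re := by
  have hn : 0 < ‖v‖ := norm_pos_iff.2 hv
  have h := hM (((‖v‖ : ℂ)⁻¹) • v) (by
    rw [norm_smul, norm_inv, Complex.norm_real, norm_norm, inv_mul_cancel₀ hn.ne'])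
  rw [map_smul, inner_smul_left, inner_smul_right, map_inv₀, Complex.conj_ofReal, ← mul_assoc,
    ← Complex.ofReal_inv, ← Complex.ofReal_mul, Complex.re_ofReal_mul] at h
  exact pos_of_mul_pos_right h (by positivity)

theorem re_inner_nonneg (hM : IsPositiveDefinite M) (v : EuclideanSpace ℂ (Fin n)) :
    0 ≤ (inner ℂ v (Matrix.toEuclideanLin M v)).re := by
  by_cases hv : v = 0
  · simp [hv]
  · exact (hM.re_inner_pos hv).le

theorem re_pos_of_mem_roots (hM : IsPositiveDefinite M) {μ : ℂ} (hμ : μ ∈ M.charpoly.roots) :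
    0 < μ.re := by
  obtain ⟨v, hv⟩ := ((mem_roots_charpoly_iff M).1 (Multiset.mem_toFinset.2 hμ)).exists_hasEigenvector
  have hv0 : WithLp.toLp 2 v ≠ 0 := fun h => hv.2 (by simpa using h)
  have hv1 : Matrix.toEuclideanLin M (WithLp.toLp 2 v) = μ • WithLp.toLp 2 v := by
    rw [Matrix.toLpLin_toLp, hv.apply_eq_smul, WithLp.toLp_smul]
  have h := hM.re_inner_pos hv0
  rw [hv1, inner_smul_right, inner_self_eq_norm_sq_to_K] at h
  have h2 : (μ * ((‖WithLp.toLp 2 v‖ : ℝ) : ℂ) ^ 2).re = μ.re * ‖WithLp.toLp 2 v‖ ^ 2 := by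
    rw [← Complex.ofReal_pow, Complex.re_mul_ofReal]
  erw [h2] at h
  exact pos_of_mul_pos_left h (by positivity)

/-- The cross term in the expanded square is `2x Re⟨v, Mv⟩ ≥ 0`. This is the bound `‖M (M + x)⁻¹‖ ≤
1`. -/
theorem norm_le_norm_add_smul (hM : IsPositiveDefinite M) {x : ℝ} (hx : 0 ≤ x)
    (v : EuclideanSpace ℂ (Fin n)) :
    ‖Matrix.toEuclideanLin M v‖ ≤ ‖Matrix.toEuclideanLin M v + (x : ℂ) • v‖ := by
  have h := norm_add_sq (𝕜 := ℂ) (Matrix.toEuclideanLin M v) ((x : ℂ) • v)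
  have h1 : RCLike.re (inner ℂ (Matrix.toEuclideanLin M v) ((x : ℂ) • v)) =
      x * (inner ℂ v (Matrix.toEuclideanLin M v)).re := by
    rw [inner_re_symm, inner_smul_left]
    simp
  have h2 := mul_nonneg hx (hM.re_inner_nonneg v)
  rw [h1] at h
  refine le_of_sq_le_sq ?_ (norm_nonneg _)
  nlinarith [sq_nonneg ‖(x : ℂ) • v‖]

theorem isUnit_det_add (hM : IsPositiveDefinite M) {x : ℝ} (hx : 0 ≤ x) :
    IsUnit (M - (-(x : ℂ)) • (1 : Matrix (Fin n) (Fin n) ℂ)).det :=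
  isUnit_det_sub_smul_one M fun _ hμ => add_ofReal_ne_zero (hM.re_pos_of_mem_roots hμ) hx

end IsPositiveDefinite

theorem toEuclideanLin_sub_neg_smul_one {n : ℕ} (M : Matrix (Fin n) (Fin n) ℂ) (t : ℂ)
    (v : EuclideanSpace ℂ (Fin n)) :
    Matrix.toEuclideanLin (M - (-t) • (1 : Matrix (Fin n) (Fin n) ℂ)) v =
      Matrix.toEuclideanLin M v + t • v := by
  simp [Matrix.toLpLin_one]

theorem toEuclideanLin_apply_inv {n : ℕ} {A : Matrix (Fin n) (Fin n) ℂ} (hA : IsUnit A.det)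
    (v : EuclideanSpace ℂ (Fin n)) :
    Matrix.toEuclideanLin A (Matrix.toEuclideanLin A⁻¹ v) = v := by
  rw [← LinearMap.comp_apply, ← Matrix.toLpLin_mul_same, Matrix.mul_nonsing_inv _ hA,
    Matrix.toLpLin_one, LinearMap.id_apply]

theorem toEuclideanLin_inv_apply {n : ℕ} {A : Matrix (Fin n) (Fin n) ℂ} (hA : IsUnit A.det)
    (v : EuclideanSpace ℂ (Fin n)) :
    Matrix.toEuclideanLin A⁻¹ (Matrix.toEuclideanLin A v) = v := by
  rw [← LinearMap.comp_apply, ← Matrix.toLpLin_mul_same, Matrix.nonsing_inv_mul _ hA,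
    Matrix.toLpLin_one, LinearMap.id_apply]

/-! ### Hessenberg matrices -/

/-- Deleting row `0` and the last column leaves an upper triangular minor with the subdiagonal of
`H` on its diagonal. The shift `z` sits strictly above that diagonal, so it drops out of the
determinant. -/
theorem adjugate_sub_smul_one_last_zero {m : ℕ} (H : Matrix (Fin (m + 1)) (Fin (m + 1)) ℂ)
    (hH : ∀ i j : Fin (m + 1), (j : ℕ) + 1 < i → H i j = 0) (z : ℂ) :
    (H - z • (1 : Matrix (Fin (m + 1)) (Fin (m + 1)) ℂ)).adjugate (Fin.last m) 0 =
      (-1) ^ m * ∏ i : Fin m, H i.succ i.castSucc := by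
  rw [Matrix.adjugate_fin_succ_eq_det_submatrix, Matrix.det_of_isUpperTriangular]
  · simp only [Fin.val_zero, Fin.val_last, zero_add]
    congr 1
    refine Finset.prod_congr rfl fun i _ => ?_
    simp [Matrix.one_apply_ne (Fin.castSucc_lt_succ (i := i)).ne']
  · intro i j hij
    have hij : j < i := hij
    have h1 : i.succ ≠ j.castSucc := fun h => by
      have := congrArg Fin.val h
      simp at this
      omega
    simp [Matrix.one_apply_ne h1, hH i.succ j.castSucc (by simpa using hij)]

theorem exists_det_mul_inv_last_zero {m : ℕ} (hm : 0 < m) (H : Matrix (Fin m) (Fin m) ℂ)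
    (hH : ∀ i j : Fin m, (j : ℕ) + 1 < i → H i j = 0) :
    ∃ c : ℂ, ∀ z : ℂ, IsUnit (H - z • (1 : Matrix (Fin m) (Fin m) ℂ)).det →
      (H - z • (1 : Matrix (Fin m) (Fin m) ℂ)).det *
        (H - z • (1 : Matrix (Fin m) (Fin m) ℂ))⁻¹ ⟨m - 1, by omega⟩ ⟨0, hm⟩ = c := by
  obtain ⟨m, rfl⟩ := Nat.exists_eq_succ_of_ne_zero hm.ne'
  refine ⟨(-1) ^ m * ∏ i : Fin m, H i.succ i.castSucc, fun z hz => ?_⟩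
  rw [← adjugate_sub_smul_one_last_zero H hH z, Matrix.inv_def, Ring.inverse_eq_inv',
    Matrix.smul_apply, smul_eq_mul, mul_inv_cancel_left₀ hz.ne_zero]
  rfl

/-! ### The Arnoldi process -/

section Orthogonalize

variable {n : ℕ} {q q' : ℕ → EuclideanSpace ℂ (Fin n)} (w : EuclideanSpace ℂ (Fin n))

theorem orthogonalize_congr {i : ℕ} (h : ∀ l < i, q l = q' l) :
    orthogonalize q w i = orthogonalize q' w i := by
  induction i with
  | zero => rfl
  | succ i ih =>
    simp only [orthogonalize]
    rw [ih fun l hl => h l (hl.trans i.lt_succ_self), h i i.lt_succ_self]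

theorem orthogonalize_add_sum (q : ℕ → EuclideanSpace ℂ (Fin n)) (i : ℕ) :
    orthogonalize q w i + ∑ l ∈ Finset.range i, inner ℂ (q l) (orthogonalize q w l) • q l = w := by
  induction i with
  | zero => simp [orthogonalize]
  | succ i ih =>
    rw [Finset.sum_range_succ, orthogonalize]
    conv_rhs => rw [← ih]
    abel

/-- Step `i` removes the component along `q i` and, by orthonormality, leaves the vanishing earlier
ones untouched. -/
theorem inner_orthogonalize {m : ℕ}
    (hq : ∀ i < m, ∀ j < m, inner ℂ (q i) (q j) = if i = j then (1 : ℂ) else 0) {i : ℕ}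
    (hi : i ≤ m) {l : ℕ} (hl : l < i) : inner ℂ (q l) (orthogonalize q w i) = 0 := by
  induction i with
  | zero => omega
  | succ i ih =>
    rw [orthogonalize, inner_sub_right, inner_smul_right, hq l (by omega) i (by omega)]
    by_cases h : l = i
    · simp [h]
    · rw [ih (by omega) (by omega)]
      simp [h]

end Orthogonalize

section Arnoldi

variable {n : ℕ} (M : Matrix (Fin n) (Fin n) ℂ) (b : EuclideanSpace ℂ (Fin n))

theorem arnoldiState_of_le {i j : ℕ} (h : i ≤ j) :
    arnoldiState M b j i = arnoldiVector M b i := by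
  induction j with
  | zero => rw [Nat.le_zero.1 h]; rfl
  | succ j ih =>
    by_cases hi : i = j + 1
    · rw [hi]; rfl
    · rw [arnoldiState, Function.update_of_ne hi, ih (by omega)]

theorem arnoldiVector_zero : arnoldiVector M b 0 = ((‖b‖ : ℂ)⁻¹) • b := by
  simp [arnoldiVector, arnoldiState]

theorem arnoldiVector_succ (j : ℕ) :
    arnoldiVector M b (j + 1) =
      ((‖arnoldiWork M b j (j + 1)‖ : ℂ)⁻¹) • arnoldiWork M b j (j + 1) := by
  have h : orthogonalize (arnoldiState M b j) (Matrix.toEuclideanLin M (arnoldiState M b j j))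
      (j + 1) = arnoldiWork M b j (j + 1) :=
    orthogonalize_congr _ fun l hl => arnoldiState_of_le M b (Nat.lt_succ_iff.1 hl)
  rw [arnoldiVector, arnoldiState, Function.update_self, h]

theorem arnoldiEntry_succ_self (j : ℕ) :
    arnoldiEntry M b (j + 1) j = (‖arnoldiWork M b j (j + 1)‖ : ℂ) := by
  simp [arnoldiEntry]

/-- True also at breakdown, where both sides vanish. -/
theorem arnoldiEntry_succ_smul (j : ℕ) :
    arnoldiEntry M b (j + 1) j • arnoldiVector M b (j + 1) = arnoldiWork M b j (j + 1) := by
  rw [arnoldiEntry_succ_self, arnoldiVector_succ, smul_smul]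
  by_cases h : arnoldiWork M b j (j + 1) = 0
  · simp [h]
  · rw [mul_inv_cancel₀ (by simpa using h), one_smul]

theorem arnoldiEntry_eq_zero {i j : ℕ} (h : j + 1 < i) : arnoldiEntry M b i j = 0 := by
  rw [arnoldiEntry, if_neg (by omega), if_neg (by omega)]

theorem inner_self_inv_norm_smul {v : EuclideanSpace ℂ (Fin n)} (hv : v ≠ 0) :
    inner ℂ (((‖v‖ : ℂ)⁻¹) • v) (((‖v‖ : ℂ)⁻¹) • v) = (1 : ℂ) := by
  have h : ‖((‖v‖ : ℂ)⁻¹) • v‖ = 1 := by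
    rw [norm_smul, norm_inv, Complex.norm_real, norm_norm, inv_mul_cancel₀ (norm_ne_zero_iff.2 hv)]
  rw [inner_self_eq_norm_sq_to_K, h]
  simp

variable {M b}

theorem inner_arnoldiVector (hb : b ≠ 0) {m : ℕ}
    (hm : ∀ j : ℕ, j + 1 < m → arnoldiEntry M b (j + 1) j ≠ 0) :
    ∀ i < m, ∀ j < m,
      inner ℂ (arnoldiVector M b i) (arnoldiVector M b j) = if i = j then (1 : ℂ) else 0 := by
  induction m with
  | zero => intro i hi; omega
  | succ m ih =>
    have ih := ih fun j hj => hm j (by omega)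
    have hlast : inner ℂ (arnoldiVector M b m) (arnoldiVector M b m) = (1 : ℂ) := by
      cases m with
      | zero => rw [arnoldiVector_zero]; exact inner_self_inv_norm_smul hb
      | succ m =>
        rw [arnoldiVector_succ]
        refine inner_self_inv_norm_smul fun h => hm m (by omega) ?_
        simp [arnoldiEntry_succ_self, h]
    have horth : ∀ i < m, inner ℂ (arnoldiVector M b i) (arnoldiVector M b m) = (0 : ℂ) := by
      intro i hi
      cases m with
      | zero => omega
      | succ m =>
        rw [arnoldiVector_succ, inner_smul_right, arnoldiWork,
          inner_orthogonalize _ ih le_rfl hi, mul_zero]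
    intro i hi j hj
    by_cases him : i = m
    · by_cases hjm : j = m
      · rw [him, hjm, hlast, if_pos rfl]
      · rw [him, ← inner_conj_symm, horth j (by omega), if_neg (by omega), map_zero]
    · by_cases hjm : j = m
      · rw [hjm, horth i (by omega), if_neg (by omega)]
      · exact ih i (by omega) j (by omega)

-- Column `j` of `M Q = Q H + w e_mᵀ`: only the last column leaves a remainder, as otherwise that
-- remainder is `h_{j+2,j+1} q_{j+2}` (indices from `1`) and belongs to the sum.
variable (M b) in
theorem toEuclideanLin_arnoldiVector {j m : ℕ} (hj : j < m) :
    Matrix.toEuclideanLin M (arnoldiVector M b j) =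
      (∑ i ∈ Finset.range m, arnoldiEntry M b i j • arnoldiVector M b i) +
        if j + 1 = m then arnoldiWork M b j (j + 1) else 0 := by
  have h := orthogonalize_add_sum (Matrix.toEuclideanLin M (arnoldiVector M b j))
    (arnoldiVector M b) (j + 1)
  have h1 : ∑ l ∈ Finset.range (j + 1), inner ℂ (arnoldiVector M b l)
      (orthogonalize (arnoldiVector M b) (Matrix.toEuclideanLin M (arnoldiVector M b j)) l) •
        arnoldiVector M b l = ∑ l ∈ Finset.range (j + 1),
          arnoldiEntry M b l j • arnoldiVector M b l := by
    refine Finset.sum_congr rfl fun l hl => ?_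
    rw [arnoldiEntry, if_pos (Nat.lt_succ_iff.1 (Finset.mem_range.1 hl)), arnoldiWork]
  rw [h1] at h
  change arnoldiWork M b j (j + 1) + _ = _ at h
  rw [← h]
  split_ifs with hjm
  · rw [hjm, add_comm]
  · rw [add_zero, ← arnoldiEntry_succ_smul, add_comm, ← Finset.sum_range_succ
      (fun l => arnoldiEntry M b l j • arnoldiVector M b l)]
    refine Finset.sum_subset (Finset.range_mono (by omega)) fun i _ hi => ?_
    rw [arnoldiEntry_eq_zero M b (by simpa using hi), zero_smul]

/-- The defining predicate is vacuous at `m = 1 ≤ k`, so the greatest such `m` satisfies it. -/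
theorem arnoldiSteps_spec {k : ℕ} (hk : 1 ≤ k) :
    ∀ j : ℕ, j + 1 < arnoldiSteps M b k → arnoldiEntry M b (j + 1) j ≠ 0 := by
  classical
  have h := Nat.findGreatest_spec
    (P := fun m => ∀ j : ℕ, j + 1 < m → arnoldiEntry M b (j + 1) j ≠ 0) hk (fun j hj => by omega)
  unfold arnoldiSteps
  convert h

theorem arnoldiSteps_pos {k : ℕ} (hk : 1 ≤ k) : 0 < arnoldiSteps M b k := by
  classical
  have h := Nat.le_findGreatest
    (P := fun m => ∀ j : ℕ, j + 1 < m → arnoldiEntry M b (j + 1) j ≠ 0) hk (fun j hj => by omega)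
  refine lt_of_lt_of_le one_pos ?_
  unfold arnoldiSteps
  convert h

theorem toEuclideanLin_arnoldiQ (k : ℕ) (y : EuclideanSpace ℂ (Fin (arnoldiSteps M b k))) :
    Matrix.toEuclideanLin (arnoldiQ M b k) y = ∑ i, y i • arnoldiVector M b i := by
  ext l
  simp [Matrix.toLpLin_apply, Matrix.mulVec, dotProduct, arnoldiQ, mul_comm]

theorem toEuclideanLin_mul_arnoldiQ {k : ℕ} (hk : 1 ≤ k)
    (y : EuclideanSpace ℂ (Fin (arnoldiSteps M b k))) :
    Matrix.toEuclideanLin M (Matrix.toEuclideanLin (arnoldiQ M b k) y) =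
      Matrix.toEuclideanLin (arnoldiQ M b k) (Matrix.toEuclideanLin (arnoldiH M b k) y) +
        y ⟨arnoldiSteps M b k - 1, Nat.sub_lt (arnoldiSteps_pos hk) one_pos⟩ •
          arnoldiWork M b (arnoldiSteps M b k - 1) (arnoldiSteps M b k) := by
  have hm := arnoldiSteps_pos (M := M) (b := b) hk
  rw [toEuclideanLin_arnoldiQ, toEuclideanLin_arnoldiQ, map_sum]
  have h1 : ∀ i : Fin (arnoldiSteps M b k), Matrix.toEuclideanLin M (y i • arnoldiVector M b i) =
      (∑ l : Fin (arnoldiSteps M b k), (arnoldiH M b k l i * y i) • arnoldiVector M b l) +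
        if i = ⟨arnoldiSteps M b k - 1, Nat.sub_lt hm one_pos⟩ then
          y i • arnoldiWork M b (arnoldiSteps M b k - 1) (arnoldiSteps M b k) else 0 := by
    intro i
    rw [map_smul, toEuclideanLin_arnoldiVector M b i.2, smul_add, Finset.smul_sum,
      Finset.sum_range]
    congr 1
    · refine Finset.sum_congr rfl fun l _ => ?_
      rw [smul_smul, mul_comm]
      rfl
    · by_cases h : (i : ℕ) + 1 = arnoldiSteps M b k
      · have h' : (i : ℕ) = arnoldiSteps M b k - 1 := by omega
        have h2 : i = ⟨arnoldiSteps M b k - 1, Nat.sub_lt hm one_pos⟩ := Fin.ext h'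
        rw [if_pos h, if_pos h2, h, h']
      · have h2 : i ≠ ⟨arnoldiSteps M b k - 1, Nat.sub_lt hm one_pos⟩ := fun h2 => h (by
          have := congrArg Fin.val h2
          simp only at this
          omega)
        rw [if_neg h, if_neg h2, smul_zero]
  rw [Finset.sum_congr rfl fun i _ => h1 i, Finset.sum_add_distrib, Finset.sum_comm,
    Finset.sum_ite_eq' Finset.univ, if_pos (Finset.mem_univ _)]
  congr 1
  refine Finset.sum_congr rfl fun l _ => ?_
  rw [← Finset.sum_smul]
  rfl

theorem orthonormal_arnoldiVector (hb : b ≠ 0) {k : ℕ} (hk : 1 ≤ k) :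
    Orthonormal ℂ (fun i : Fin (arnoldiSteps M b k) => arnoldiVector M b i) := by
  rw [orthonormal_iff_ite]
  intro i j
  rw [inner_arnoldiVector hb (arnoldiSteps_spec hk) i i.2 j j.2]
  simp only [Fin.ext_iff]

theorem inner_toEuclideanLin_arnoldiQ (hb : b ≠ 0) {k : ℕ} (hk : 1 ≤ k)
    (y z : EuclideanSpace ℂ (Fin (arnoldiSteps M b k))) :
    inner ℂ (Matrix.toEuclideanLin (arnoldiQ M b k) y) (Matrix.toEuclideanLin (arnoldiQ M b k) z) =
      (inner ℂ y z : ℂ) := by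
  rw [toEuclideanLin_arnoldiQ, toEuclideanLin_arnoldiQ,
    (orthonormal_arnoldiVector hb hk).inner_sum, PiLp.inner_apply]
  exact Finset.sum_congr rfl fun i _ => by rw [RCLike.inner_apply, mul_comm]

theorem inner_arnoldiQ_arnoldiWork (hb : b ≠ 0) {k : ℕ} (hk : 1 ≤ k)
    (y : EuclideanSpace ℂ (Fin (arnoldiSteps M b k))) (j : ℕ) :
    inner ℂ (Matrix.toEuclideanLin (arnoldiQ M b k) y)
      (arnoldiWork M b j (arnoldiSteps M b k)) = (0 : ℂ) := by
  rw [toEuclideanLin_arnoldiQ, sum_inner]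
  refine Finset.sum_eq_zero fun i _ => ?_
  rw [inner_smul_left, arnoldiWork,
    inner_orthogonalize _ (inner_arnoldiVector hb (arnoldiSteps_spec hk)) le_rfl i.2, mul_zero]

/-- The remainder `w` is orthogonal to the range of the isometry `Q`, so `⟨y, Hy⟩ = ⟨Qy, MQy⟩`. -/
theorem isPositiveDefinite_arnoldiH (hM : IsPositiveDefinite M) (hb : b ≠ 0) {k : ℕ}
    (hk : 1 ≤ k) : IsPositiveDefinite (arnoldiH M b k) := by
  intro y hy
  have h := toEuclideanLin_mul_arnoldiQ (M := M) (b := b) hk y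
  have h1 : inner ℂ (Matrix.toEuclideanLin (arnoldiQ M b k) y)
      (Matrix.toEuclideanLin M (Matrix.toEuclideanLin (arnoldiQ M b k) y)) =
      inner ℂ y (Matrix.toEuclideanLin (arnoldiH M b k) y) := by
    rw [h, inner_add_right, inner_smul_right, inner_arnoldiQ_arnoldiWork hb hk,
      inner_toEuclideanLin_arnoldiQ hb hk, mul_zero, add_zero]
  rw [← h1]
  refine hM.re_inner_pos fun h0 => ?_
  have h2 := inner_toEuclideanLin_arnoldiQ (M := M) hb hk y y
  rw [h0, inner_zero_left] at h2
  have := inner_self_eq_zero.1 h2.symm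
  simp [this] at hy

theorem smul_arnoldiVector_zero (hb : b ≠ 0) : (‖b‖ : ℂ) • arnoldiVector M b 0 = b := by
  rw [arnoldiVector_zero, smul_smul, mul_inv_cancel₀ (by simpa using hb), one_smul]

/-- The vector `‖b‖ e₁`. -/
noncomputable def normSmulFirst (m : ℕ) (b : EuclideanSpace ℂ (Fin n)) : EuclideanSpace ℂ (Fin m) :=
  WithLp.toLp 2 fun i => if (i : ℕ) = 0 then (‖b‖ : ℂ) else 0

theorem toEuclideanLin_arnoldiQ_normSmulFirst (hb : b ≠ 0) {k : ℕ} (hk : 1 ≤ k) :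
    Matrix.toEuclideanLin (arnoldiQ M b k) (normSmulFirst _ b) = b := by
  rw [toEuclideanLin_arnoldiQ, Finset.sum_eq_single_of_mem ⟨0, arnoldiSteps_pos hk⟩
    (Finset.mem_univ _)]
  · simpa [normSmulFirst] using smul_arnoldiVector_zero hb
  · intro i _ hi
    have : (i : ℕ) ≠ 0 := fun h => hi (Fin.ext h)
    simp [normSmulFirst, this]

theorem toEuclideanLin_conjTranspose_arnoldiQ (hb : b ≠ 0) {k : ℕ} (hk : 1 ≤ k) :
    Matrix.toEuclideanLin (arnoldiQ M b k)ᴴ b = normSmulFirst _ b := by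
  refine ext_inner_left ℂ fun y => ?_
  rw [Matrix.toEuclideanLin_conjTranspose_eq_adjoint, LinearMap.adjoint_inner_right,
    ← inner_toEuclideanLin_arnoldiQ (M := M) hb hk, toEuclideanLin_arnoldiQ_normSmulFirst hb hk]

end Arnoldi

/-! ### The error of the full orthogonalization method -/

section FOM

variable {n : ℕ} {M : Matrix (Fin n) (Fin n) ℂ} {b : EuclideanSpace ℂ (Fin n)}

theorem fomError_eq (k : ℕ) (z : ℂ) :
    fomError M b k z = Matrix.toEuclideanLin (M - z • 1)⁻¹ b -
      Matrix.toEuclideanLin (arnoldiQ M b k)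
        (Matrix.toEuclideanLin (arnoldiH M b k - z • 1)⁻¹ (normSmulFirst _ b)) := by
  rw [fomError, Matrix.toLpLin_mul_same, LinearMap.comp_apply]
  rfl

/-- The point is that `w` does not depend on `x`: the residuals of all the shifted systems are
collinear, with lengths governed by the determinant alone. -/
theorem exists_toEuclideanLin_fomError (hM : IsPositiveDefinite M) (hb : b ≠ 0) {k : ℕ}
    (hk : 1 ≤ k) :
    ∃ w : EuclideanSpace ℂ (Fin n), ∀ x : ℝ, 0 ≤ x →
      Matrix.toEuclideanLin M (fomError M b k (-(x : ℂ))) + (x : ℂ) • fomError M b k (-(x : ℂ)) =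
        (arnoldiH M b k - (-(x : ℂ)) •
          (1 : Matrix (Fin (arnoldiSteps M b k)) (Fin (arnoldiSteps M b k)) ℂ)).det⁻¹ • w := by
  have hm := arnoldiSteps_pos (M := M) (b := b) hk
  obtain ⟨c, hc⟩ := exists_det_mul_inv_last_zero hm (arnoldiH M b k)
    (fun i j hij => arnoldiEntry_eq_zero M b hij)
  refine ⟨-((c * ‖b‖) • arnoldiWork M b (arnoldiSteps M b k - 1) (arnoldiSteps M b k)),
    fun x hx => ?_⟩
  have hHu := (isPositiveDefinite_arnoldiH hM hb hk).isUnit_det_add hx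
  have hlast : (Matrix.toEuclideanLin (arnoldiH M b k - (-(x : ℂ)) •
      (1 : Matrix (Fin (arnoldiSteps M b k)) (Fin (arnoldiSteps M b k)) ℂ))⁻¹ (normSmulFirst _ b))
      ⟨arnoldiSteps M b k - 1, Nat.sub_lt hm one_pos⟩ =
      (arnoldiH M b k - (-(x : ℂ)) •
        (1 : Matrix (Fin (arnoldiSteps M b k)) (Fin (arnoldiSteps M b k)) ℂ)).det⁻¹ *
        (c * ‖b‖) := by
    rw [← hc _ hHu, mul_assoc, inv_mul_cancel_left₀ hHu.ne_zero, Matrix.toLpLin_apply]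
    simp only [Matrix.mulVec, dotProduct, normSmulFirst]
    rw [Finset.sum_eq_single_of_mem ⟨0, hm⟩ (Finset.mem_univ _)]
    · simp
    · intro i _ hi
      have : (i : ℕ) ≠ 0 := fun h => hi (Fin.ext h)
      simp [this]
  have hy := toEuclideanLin_apply_inv hHu (normSmulFirst _ b)
  rw [fomError_eq]
  set y := Matrix.toEuclideanLin (arnoldiH M b k - (-(x : ℂ)) •
      (1 : Matrix (Fin (arnoldiSteps M b k)) (Fin (arnoldiSteps M b k)) ℂ))⁻¹ (normSmulFirst _ b)
  have hu := toEuclideanLin_apply_inv (hM.isUnit_det_add hx) b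
  rw [toEuclideanLin_sub_neg_smul_one] at hu hy
  have hyQ := congrArg (Matrix.toEuclideanLin (arnoldiQ M b k)) hy
  rw [toEuclideanLin_arnoldiQ_normSmulFirst hb hk, map_add, map_smul] at hyQ
  have hMy := toEuclideanLin_mul_arnoldiQ hk y
  rw [hlast] at hMy
  rw [map_sub, hMy, smul_neg, smul_smul, smul_sub]
  set p := Matrix.toEuclideanLin (M - (-(x : ℂ)) • 1)⁻¹ b
  set W := arnoldiWork M b (arnoldiSteps M b k - 1) (arnoldiSteps M b k)
  -- The exact system `(M + x) p = b` minus the projected one `Q (H + x) y = b`; only the remainder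
  -- of the Arnoldi relation survives.
  linear_combination (norm := module) hu - hyQ

theorem norm_fomError_le (hM : IsPositiveDefinite M) (hb : b ≠ 0) {k : ℕ} (hk : 1 ≤ k) {x : ℝ}
    (hx : 0 ≤ x) :
    ‖fomError M b k (-(x : ℂ))‖ ≤
      ((arnoldiH M b k).charpoly.roots.map fun μ : ℂ => ‖μ / (μ + (x : ℂ))‖).prod *
        ‖fomError M b k 0‖ := by
  obtain ⟨w, hw⟩ := exists_toEuclideanLin_fomError hM hb hk
  have hH := isPositiveDefinite_arnoldiH hM hb hk
  have hw0 := hw 0 le_rfl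
  have hwx := hw x hx
  have hd0 := (hH.isUnit_det_add le_rfl).ne_zero
  have hratio : ((arnoldiH M b k).charpoly.roots.map fun μ : ℂ => ‖μ / (μ + (x : ℂ))‖).prod =
      ‖(arnoldiH M b k - (-((0 : ℝ) : ℂ)) •
        (1 : Matrix (Fin (arnoldiSteps M b k)) (Fin (arnoldiSteps M b k)) ℂ)).det /
      (arnoldiH M b k - (-(x : ℂ)) •
        (1 : Matrix (Fin (arnoldiSteps M b k)) (Fin (arnoldiSteps M b k)) ℂ)).det‖ := by
    rw [det_sub_smul_one_eq, det_sub_smul_one_eq, ← Multiset.prod_map_div]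
    simp only [Complex.ofReal_zero, add_zero]
    have h := map_multiset_prod (normHom (α := ℂ))
      ((arnoldiH M b k).charpoly.roots.map fun μ => μ / (μ + (x : ℂ)))
    rw [Multiset.map_map] at h
    exact h.symm
  rw [hratio]
  set d0 := (arnoldiH M b k - (-((0 : ℝ) : ℂ)) •
        (1 : Matrix (Fin (arnoldiSteps M b k)) (Fin (arnoldiSteps M b k)) ℂ)).det
  set d := (arnoldiH M b k - (-(x : ℂ)) •
        (1 : Matrix (Fin (arnoldiSteps M b k)) (Fin (arnoldiSteps M b k)) ℂ)).det
  rw [Complex.ofReal_zero, neg_zero, zero_smul, add_zero] at hw0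
  have hMx := hM.isUnit_det_add hx
  have hu := toEuclideanLin_apply_inv hMx (fomError M b k 0)
  set u := Matrix.toEuclideanLin (M - (-(x : ℂ)) • 1)⁻¹ (fomError M b k 0)
  have hw' : w = d0 • Matrix.toEuclideanLin M (fomError M b k 0) := by
    rw [hw0, smul_smul, mul_inv_cancel₀ hd0, one_smul]
  -- Both sides have the same image under the invertible `M + x`, which commutes with `M`.
  have hxi : fomError M b k (-(x : ℂ)) = (d0 / d) • Matrix.toEuclideanLin M u := by
    rw [← toEuclideanLin_inv_apply hMx (fomError M b k (-(x : ℂ))),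
      ← toEuclideanLin_inv_apply hMx ((d0 / d) • Matrix.toEuclideanLin M u),
      toEuclideanLin_sub_neg_smul_one, hwx, hw', ← hu, toEuclideanLin_sub_neg_smul_one,
      toEuclideanLin_sub_neg_smul_one]
    congr 1
    simp only [map_add, map_smul, smul_add, smul_smul]
    ring_nf
  rw [hxi, norm_smul]
  refine mul_le_mul_of_nonneg_left ?_ (norm_nonneg _)
  rw [toEuclideanLin_sub_neg_smul_one] at hu
  rw [← hu]
  exact hM.norm_le_norm_add_smul hx u

theorem arnoldiApprox_eq (hb : b ≠ 0) (f : ℂ → ℂ) {k : ℕ} (hk : 1 ≤ k) :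
    arnoldiApprox f M b k = Matrix.toEuclideanLin (arnoldiQ M b k)
      (Matrix.toEuclideanLin (matrixFunction f (arnoldiH M b k)) (normSmulFirst _ b)) := by
  rw [arnoldiApprox, Matrix.toLpLin_mul_same, Matrix.toLpLin_mul_same, LinearMap.comp_apply,
    LinearMap.comp_apply, toEuclideanLin_conjTranspose_arnoldiQ hb hk]

theorem sqrtIntegrand_sub_eq (hb : b ≠ 0) {k : ℕ} (hk : 1 ≤ k) (x : ℝ) :
    sqrtIntegrand M b x - Matrix.toEuclideanLin (arnoldiQ M b k)
      (sqrtIntegrand (arnoldiH M b k) (normSmulFirst _ b) x) =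
      -(((√x : ℝ) : ℂ) • fomError M b k (-(x : ℂ))) := by
  rw [sqrtIntegrand, sqrtIntegrand, map_sub, map_smul, map_smul,
    toEuclideanLin_arnoldiQ_normSmulFirst hb hk, fomError_eq]
  module

/-- Each `sqrtIntegrand` is integrated whole: its two terms are in general not integrable
separately. -/
theorem pi_smul_sqrt_error (hM : IsPositiveDefinite M) (hb : b ≠ 0) {k : ℕ} (hk : 1 ≤ k) :
    (Real.pi : ℂ) • (Matrix.toEuclideanLin (matrixFunction principalSqrt M) b
      - arnoldiApprox principalSqrt M b k) =
      ∫ x in Set.Ioi (0 : ℝ), -(((√x : ℝ) : ℂ) • fomError M b k (-(x : ℂ))) := by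
  have hM' := fun μ (hμ : μ ∈ M.charpoly.roots) => hM.re_pos_of_mem_roots hμ
  have hH' := fun μ (hμ : μ ∈ (arnoldiH M b k).charpoly.roots) =>
    (isPositiveDefinite_arnoldiH hM hb hk).re_pos_of_mem_roots hμ
  have hint := integrableOn_sqrtIntegrand (arnoldiH M b k) hH' (normSmulFirst _ b)
  let L := LinearMap.toContinuousLinearMap (Matrix.toEuclideanLin (arnoldiQ M b k))
  have hL := L.integral_comp_comm hint
  rw [integral_sqrtIntegrand (arnoldiH M b k) hH'] at hL
  rw [← setIntegral_congr_fun measurableSet_Ioi fun x _ => sqrtIntegrand_sub_eq hb hk x]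
  have hsub := integral_sub (integrableOn_sqrtIntegrand M hM' b) (L.integrable_comp hint)
  rw [hL, integral_sqrtIntegrand M hM', map_smul, ← smul_sub] at hsub
  rw [arnoldiApprox_eq hb _ hk]
  exact hsub.symm

end FOM

theorem mainTheorem1 {n : ℕ} (M : Matrix (Fin n) (Fin n) ℂ) (hM : IsPositiveDefinite M)
    (b : EuclideanSpace ℂ (Fin n)) (k : ℕ) (hk : 1 ≤ k) :
    ENNReal.ofReal
        ‖Matrix.toEuclideanLin (matrixFunction principalSqrt M) b
          - arnoldiApprox principalSqrt M b k‖
      ≤ ENNReal.ofReal (1 / Real.pi) *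
          (∫⁻ x in Set.Ioi (0 : ℝ), ENNReal.ofReal (x ^ (1 / 2 : ℝ) *
            ((arnoldiH M b k).charpoly.roots.map fun μ : ℂ => ‖μ / (μ + (x : ℂ))‖).prod)) *
          ENNReal.ofReal ‖fomError M b k 0‖ := by
  by_cases hb : b = 0
  · simp [hb, arnoldiApprox]
  have herr : Matrix.toEuclideanLin (matrixFunction principalSqrt M) b
      - arnoldiApprox principalSqrt M b k = ((1 / Real.pi : ℝ) : ℂ) •
      ∫ x in Set.Ioi (0 : ℝ), -(((√x : ℝ) : ℂ) • fomError M b k (-(x : ℂ))) := by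
    rw [← pi_smul_sqrt_error hM hb hk, smul_smul, ← Complex.ofReal_mul,
      one_div_mul_cancel Real.pi_ne_zero, Complex.ofReal_one, one_smul]
  rw [herr, norm_smul, Complex.norm_real, Real.norm_of_nonneg (by positivity),
    ENNReal.ofReal_mul (by positivity), mul_assoc, ofReal_norm]
  refine mul_le_mul_right ((enorm_integral_le_lintegral_enorm _).trans ?_) _
  -- Only finiteness of the constant matters, so an infinite integral with `ξ_0 = 0` is covered too.
  rw [← lintegral_mul_const' _ _ ENNReal.ofReal_ne_top]
  refine setLIntegral_mono' measurableSet_Ioi fun x hx => ?_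
  have hx : (0 : ℝ) < x := hx
  have hprod : 0 ≤ ((arnoldiH M b k).charpoly.roots.map fun μ : ℂ => ‖μ / (μ + (x : ℂ))‖).prod :=
    Multiset.prod_nonneg fun a ha => by
      obtain ⟨μ, _, rfl⟩ := Multiset.mem_map.1 ha
      exact norm_nonneg _
  rw [← ofReal_norm, ← ENNReal.ofReal_mul (by positivity), norm_neg, norm_smul,
    Complex.norm_real, Real.norm_of_nonneg (Real.sqrt_nonneg x), ← Real.sqrt_eq_rpow, mul_assoc]
  exact ENNReal.ofReal_le_ofReal
    (mul_le_mul_of_nonneg_left (norm_fomError_le hM hb hk hx.le) (Real.sqrt_nonneg x))
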